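/- Consider a finite stochastic shortest path problem: a finite set $S=\{1,\dots,n\}$ of nonterminal states, a terminal state $0$, a finite nonempty set $A$ of actions, stage costs $g:S\times A\to\mathbb{R}$, and transition probabilities $P_{ij}(a)\ge 0$ with $\sum_{j\in S}P_{ij}(a)\le 1$ for all $i\in S$, $a\in A$; under action $a$ the state moves from $i$ to $j\in S$ with probability $P_{ij}(a)$ and from $i$ to $0$ with probability $1-\sum_{j\in S}P_{ij}(a)$. The state $0$ is a cost-free trap. A policy is a map $\mu:S\to A$; it is proper if the Markov chain $(s_t)$ it induces reaches $0$ with probability one from every initial state. Its (undiscounted) cost-to-go is $J^\mu(i)=\mathbb{E}\big[\sum_{t=0}^\infty g(s_t,\mu(s_t))\,\big|\,s_0=i\big]$, and the optimal cost-to-go is $J^*(i)=\min_\mu J^\mu(i)$. For $J\in\mathbb{R}^n$ put $$(T_\mu J)(i)=g(i,\mu(i))+\sum_{j\in S}P_{ij}(\mu(i))J(j),\qquad (TJ)(i)=\min_{a\in A}\Big[g(i,a)+\sum_{j\in S}P_{ij}(a)J(j)\Big],$$ and call $\mu$ greedy with respect to $J$ if $T_\mu J=TJ$. Let $(J_t)_{t\ge0}$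 be a random sequence in $\mathbb{R}^n$ generated by optimistic policy iteration (Monte Carlo Exploring Starts), $$J_{t+1}=(1-\gamma_t)J_t+\gamma_t\,(J^{\mu_t}+w_t),\qquad t\ge 0,$$ where $\mu_t$ is a policy that is greedy with respect to $J_t$, the stepsizes $\gamma_t\ge 0$ are deterministic, and the noise vectors $w_t$ satisfy, for a filtration $(\mathcal{F}_t)$ to which $(J_t)$ and $(\mu_t)$ are adapted (for instance the natural one) and for some constant $C$, $$\mathbb{E}[w_t\mid\mathcal{F}_t]=0,\qquad \mathbb{E}\big[\|w_t\|^2\mid\mathcal{F}_t\big]\le C\qquad\text{almost surely for all } t\ge 0 .$$ If all policies are proper and $\sum_{t=0}^\infty\gamma_t=\infty$, $\sum_{t=0}^\infty\gamma_t^2<\infty$, then $J_t$ converges to $J^*$ with probability one. -/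

import Mathlib

open MeasureTheory ProbabilityTheory Filter Topology
open scoped ENNReal

/-- A finite stochastic shortest path problem with nonterminal states `S` and actions `A`.
`P i a j` is the probability of moving from `i` to `j` under action `a`; the remaining mass
`1 - ∑ j, P i a j` is the probability of moving to the terminal state.
`g i a` is the cost of one stage. -/
structure SSP (S A : Type*) [Fintype S] where
  P : S → A → S → ℝ
  g : S → A → ℝ
  P_nonneg : ∀ i a j, 0 ≤ P i a j
  P_sum_le_one : ∀ i a, ∑ j, P i a j ≤ 1

/-- The state space of the controlled chain: the terminal state together with the
nonterminal states `S`. It carries the discrete σ-algebra. -/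
inductive SSPState (S : Type*) where
  | terminal : SSPState S
  | state : S → SSPState S

namespace SSP

variable {S A : Type*}

instance : MeasurableSpace (SSPState S) := ⊤

instance : DiscreteMeasurableSpace (SSPState S) := ⟨fun _ => trivial⟩

instance [Finite S] : Finite (SSPState S) :=
  Finite.of_surjective (fun o : Option S => o.elim SSPState.terminal SSPState.state) (by
    rintro (_ | i)
    · exact ⟨none, rfl⟩
    · exact ⟨some i, rfl⟩)

variable [Fintype S] (M : SSP S A)

/-- The probability of moving from `i` to the terminal state under `a`. -/
def exitProb (i : S) (a : A) : ℝ := 1 - ∑ j, M.P i a j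

/-- The law of the successor of a state under the stationary policy `π`.
The terminal state is a trap. -/
noncomputable def step (π : S → A) : SSPState S → Measure (SSPState S)
  | .terminal => Measure.dirac .terminal
  | .state i => ENNReal.ofReal (M.exitProb i (π i)) • Measure.dirac .terminal +
      ∑ j, ENNReal.ofReal (M.P i (π i) j) • Measure.dirac (.state j)

theorem isProbabilityMeasure_step (π : S → A) (s : SSPState S) :
    IsProbabilityMeasure (M.step π s) := by
  cases s with
  | terminal => unfold step; infer_instance
  | state i =>
    constructor
    have h0 : 0 ≤ M.exitProb i (π i) := sub_nonneg.2 (M.P_sum_le_one i (π i))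
    simp only [step, Measure.coe_add, Pi.add_apply, Measure.smul_apply, measure_univ,
      Measure.coe_finsetSum, Finset.sum_apply, smul_eq_mul, mul_one]
    rw [← ENNReal.ofReal_sum_of_nonneg fun j _ => M.P_nonneg i (π i) j,
      ← ENNReal.ofReal_add h0 (Finset.sum_nonneg fun j _ => M.P_nonneg i (π i) j)]
    simp [exitProb]

/-- The transition kernel of the Markov chain induced by the policy `π`. -/
noncomputable def kernel (π : S → A) : Kernel (SSPState S) (SSPState S) :=
  Kernel.ofFunOfCountable (M.step π)

instance (π : S → A) : IsMarkovKernel (M.kernel π) := ⟨M.isProbabilityMeasure_step π⟩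

/-- The same kernel, read as giving the law of the state at time `n + 1` as a function of the
history up to time `n`: only the last state matters. -/
noncomputable def historyKernel (π : S → A) (n : ℕ) :
    Kernel ((k : Finset.Iic n) → SSPState S) (SSPState S) :=
  (M.kernel π).comap (fun h => h ⟨n, Finset.mem_Iic.2 le_rfl⟩) (measurable_pi_apply _)

instance (π : S → A) (n : ℕ) : IsMarkovKernel (M.historyKernel π n) := by
  unfold historyKernel; infer_instance

/-- The law of the state trajectory `s₀, s₁, …` under the policy `π`, started at `s₀ = i`. -/
noncomputable def pathLaw (π : S → A) (i : S) : Measure (ℕ → SSPState S) :=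
  Kernel.trajMeasure (X := fun _ => SSPState S) (Measure.dirac (.state i)) (M.historyKernel π)

/-- The policy `π` is proper: from every initial state the terminal state is reached with
probability one. -/
def IsProper (π : S → A) : Prop :=
  ∀ i, ∀ᵐ s ∂M.pathLaw π i, ∃ t, s t = .terminal

/-- The cost of one stage under `π`; it vanishes at the terminal state. -/
def stageCost (π : S → A) : SSPState S → ℝ
  | .terminal => 0
  | .state i => M.g i (π i)

/-- The cost-to-go `J^π(i) = 𝔼[∑ₜ g(sₜ, π(sₜ)) | s₀ = i]`. -/
noncomputable def cost (π : S → A) (i : S) : ℝ :=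
  ∫ s, ∑' t, M.stageCost π (s t) ∂M.pathLaw π i

/-- The optimal cost-to-go `J^*(i) = min_π J^π(i)`, the minimum over all (finitely many)
policies. -/
noncomputable def optCost [DecidableEq S] [Fintype A] [Nonempty A] (i : S) : ℝ :=
  Finset.univ.inf' Finset.univ_nonempty fun π : S → A => M.cost π i

/-- The dynamic programming operator `T_π` of a policy. -/
def policyOp (π : S → A) (J : S → ℝ) (i : S) : ℝ :=
  M.g i (π i) + ∑ j, M.P i (π i) j * J j

/-- The dynamic programming operator `T`. -/
noncomputable def bellmanOp [Fintype A] [Nonempty A] (J : S → ℝ) (i : S) : ℝ :=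
  Finset.univ.inf' Finset.univ_nonempty fun a : A => M.g i a + ∑ j, M.P i a j * J j

/-- The policy `π` is greedy with respect to `J`. -/
def IsGreedy [Fintype A] [Nonempty A] (J : S → ℝ) (π : S → A) : Prop :=
  M.policyOp π J = M.bellmanOp J

end SSP

/-! Write d_t = γ_t w_t. The policy operator of μ_t is affine, agrees with T at J_t by greediness,
and fixes J^{μ_t}. Hence T J_{t+1} ≤ T_{μ_t} J_{t+1} = (1-γ_t) T J_t + γ_t J^{μ_t} + P_{μ_t} d_t.
Subtracting the update cancels J^{μ_t}: the Bellman residual T J_t - J_t is at most (1-γ_t) times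
its predecessor plus (P_{μ_t} - I) d_t. That noise has an almost surely convergent series, so the
limsup of the residual is at most 0 (`eventually_bellmanOp_le`).

A small residual makes J^{μ_t} at most T J_t plus a small error (`IsGreedy.cost_le`). Properness of
all policies gives a weighted maximum norm contracted by every transition matrix
(`exists_contraction_weights`), so the update pulls J_t below J^* up to a small error
(`exists_eventually_le_optCost_add`). The lower bound is immediate from J^{μ_t} ≥ J^*.

Probability enters only through L²-bounded martingales, which give convergence of the noise series;
the rest is deterministic along each trajectory. -/

namespace SSP

/-! ### Path law, powers of the transition matrix, and the cost series of a proper policy. -/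

variable {S A : Type*} [Fintype S] (M : SSP S A)

instance (π : S → A) (i : S) : IsProbabilityMeasure (M.pathLaw π i) := by
  unfold pathLaw; infer_instance

theorem measurableSet_coord_eq {S : Type*} (t : ℕ) (x : SSPState S) :
    MeasurableSet {s : ℕ → SSPState S | s t = x} :=
  (measurable_pi_apply (X := fun _ : ℕ => SSPState S) t) (MeasurableSet.of_discrete (s := {x}))

/-- The one-step Markov property, read off from the disintegration of the trajectory measure at time
`t`. -/
theorem lintegral_pathLaw_pair (π : S → A) (i : S) (t : ℕ)
    (F : SSPState S × SSPState S → ℝ≥0∞) :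
    ∫⁻ s, F (s t, s (t + 1)) ∂M.pathLaw π i
      = ∫⁻ s, ∫⁻ y, F (s t, y) ∂M.kernel π (s t) ∂M.pathLaw π i := by
  have hF : Measurable F := measurable_of_finite F
  have hl : Measurable fun h : (k : Finset.Iic t) → SSPState S => h ⟨t, Finset.mem_Iic.2 le_rfl⟩ :=
    measurable_pi_apply _
  have key := Kernel.map_frestrictLe_trajMeasure_compProd_eq_map_trajMeasure
    (X := fun _ => SSPState S) (κ := M.historyKernel π)
    (μ₀ := Measure.dirac (SSPState.state i)) (a := t)
  have hG : Measurable fun p : ((k : Finset.Iic t) → SSPState S) × SSPState S =>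
      F (p.1 ⟨t, Finset.mem_Iic.2 le_rfl⟩, p.2) :=
    hF.comp ((hl.comp measurable_fst).prodMk measurable_snd)
  have h := congrArg (fun ν => ∫⁻ p, F (p.1 ⟨t, Finset.mem_Iic.2 le_rfl⟩, p.2) ∂ν) key
  rw [Measure.lintegral_compProd hG, lintegral_map hG (by fun_prop),
    lintegral_map (by fun_prop) (by fun_prop)] at h
  exact h.symm

theorem lintegral_pathLaw_coord (π : S → A) (i : S) (t : ℕ) (f : SSPState S → ℝ≥0∞)
    (hf : f .terminal = 0) :
    ∫⁻ s, f (s t) ∂M.pathLaw π i = ∑ j, M.pathLaw π i {s | s t = .state j} * f (.state j) := by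
  classical
  have hm : ∀ j, MeasurableSet {s : ℕ → SSPState S | s t = .state j} := fun j =>
    measurableSet_coord_eq t _
  have h : ∀ s : ℕ → SSPState S, f (s t)
      = ∑ j, {s : ℕ → SSPState S | s t = .state j}.indicator (fun _ => f (.state j)) s := by
    intro s
    cases hs : s t with
    | terminal => simp [Set.indicator, hs, hf]
    | state k => simp [Set.indicator, hs]
  simp_rw [h]
  rw [lintegral_finsetSum _ fun j _ => measurable_const.indicator (hm j)]
  simp_rw [lintegral_indicator_const (hm _), mul_comm]

theorem map_pathLaw_zero (π : S → A) (i : S) :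
    (M.pathLaw π i).map (fun s => s 0) = Measure.dirac (.state i) := by
  have hev : (fun s : ℕ → SSPState S => s 0)
      = (fun h : (k : Finset.Iic 0) → SSPState S => h ⟨0, Finset.mem_Iic.2 le_rfl⟩) ∘
        Preorder.frestrictLe (π := fun _ => SSPState S) 0 := rfl
  have hl : Measurable fun h : (k : Finset.Iic 0) → SSPState S => h ⟨0, Finset.mem_Iic.2 le_rfl⟩ :=
    measurable_pi_apply _
  rw [hev, ← Measure.map_map hl (by fun_prop), pathLaw, Kernel.trajMeasure,
    Measure.map_comp _ _ (by fun_prop), Kernel.traj_map_frestrictLe, Kernel.partialTraj_self,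
    Measure.id_comp, Measure.map_map hl (by fun_prop)]
  convert Measure.map_id
  rfl

/-- The transition matrix between nonterminal states under `π`. -/
def transMatrix (π : S → A) : Matrix S S ℝ := Matrix.of fun i j => M.P i (π i) j

theorem step_singleton (π : S → A) (i j : S) :
    M.kernel π (.state i) {.state j} = ENNReal.ofReal (M.P i (π i) j) := by
  classical
  change M.step π (.state i) {.state j} = _
  simp [step, Set.indicator]

variable [DecidableEq S]

theorem transMatrix_pow_nonneg (π : S → A) (t : ℕ) (k l : S) :
    0 ≤ (M.transMatrix π ^ t) k l := by
  induction t generalizing l with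
  | zero => simp only [pow_zero, Matrix.one_apply]; split_ifs <;> norm_num
  | succ t ih =>
    rw [pow_succ, Matrix.mul_apply]
    exact Finset.sum_nonneg fun m _ => mul_nonneg (ih m) (M.P_nonneg _ _ _)

/-- Bridge from the chain to linear algebra: after this, path laws enter only through powers of a
substochastic matrix on `S`. -/
theorem pathLaw_coord (π : S → A) (i : S) (t : ℕ) (j : S) :
    M.pathLaw π i {s | s t = .state j} = ENNReal.ofReal ((M.transMatrix π ^ t) i j) := by
  have hnn := M.transMatrix_pow_nonneg π
  induction t generalizing j with
  | zero =>
    have h0 := M.map_pathLaw_zero π i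
    have := congrArg (fun ν => ν {SSPState.state j}) h0
    rw [Measure.map_apply (measurable_pi_apply 0) .of_discrete] at this
    refine this.trans ?_
    simp [Matrix.one_apply, Set.indicator]
    split_ifs <;> simp_all
  | succ t ih =>
    have h1 : M.pathLaw π i {s | s (t + 1) = .state j}
        = ∫⁻ s, ({.state j} : Set (SSPState S)).indicator 1 (s (t + 1)) ∂M.pathLaw π i := by
      rw [← lintegral_indicator_one (measurableSet_coord_eq _ _)]
      rfl
    rw [h1, M.lintegral_pathLaw_pair π i t
      (fun p => ({.state j} : Set (SSPState S)).indicator 1 p.2)]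
    simp_rw [lintegral_indicator_one (MeasurableSet.of_discrete (s := {SSPState.state j}))]
    rw [M.lintegral_pathLaw_coord π i t (fun x => M.kernel π x {.state j})]
    · simp_rw [ih, step_singleton]
      rw [pow_succ, Matrix.mul_apply, ENNReal.ofReal_sum_of_nonneg]
      · simp_rw [ENNReal.ofReal_mul (hnn _ _ _)]
        rfl
      · exact fun k _ => mul_nonneg (hnn _ _ _) (M.P_nonneg _ _ _)
    · change M.step π .terminal _ = 0
      simp [step]

/-- Almost every path hits the terminal state and is trapped there, so the indicator of `s t =
.state j` tends to 0; dominated convergence does the rest. -/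
theorem IsProper.tendsto_transMatrix_pow {M : SSP S A} {π : S → A} (h : M.IsProper π) :
    Tendsto (fun t => M.transMatrix π ^ t) atTop (𝓝 0) := by
  refine tendsto_pi_nhds.2 fun i => tendsto_pi_nhds.2 fun j => ?_
  have htrap : ∀ᵐ s ∂M.pathLaw π i, ∀ t, s t = .terminal → s (t + 1) = .terminal := by
    refine ae_all_iff.2 fun t => ?_
    -- The transitions that escape from the trap; they have probability zero at each time.
    set B : Set (SSPState S × SSPState S) := {p | p.1 = .terminal ∧ p.2 ≠ .terminal}
    have hp := M.lintegral_pathLaw_pair π i t (B.indicator 1)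
    have h0 : ∀ x : SSPState S, ∫⁻ y, B.indicator 1 (x, y) ∂M.kernel π x = 0 := by
      intro x
      cases x with
      | terminal =>
        change ∫⁻ y, B.indicator 1 (_, y) ∂M.step π .terminal = 0
        simp [step, lintegral_dirac, B]
      | state k => simp [B]
    simp_rw [h0, lintegral_zero] at hp
    have hmeas : Measurable fun s : ℕ → SSPState S =>
        (B.indicator 1 (s t, s (t + 1)) : ℝ≥0∞) :=
      (measurable_of_finite (B.indicator 1)).comp
        ((measurable_pi_apply t).prodMk (measurable_pi_apply (t + 1)))
    filter_upwards [(lintegral_eq_zero_iff hmeas).1 hp] with s hs ht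
    by_contra hne
    have : ((s t, s (t + 1)) : SSPState S × SSPState S) ∈ B := ⟨ht, hne⟩
    simp [this] at hs
  have hlim : Tendsto (fun t => ∫⁻ s, ({.state j} : Set (SSPState S)).indicator 1 (s t)
      ∂M.pathLaw π i) atTop (𝓝 (∫⁻ _, 0 ∂M.pathLaw π i)) := by
    refine tendsto_lintegral_of_dominated_convergence (fun _ => 1) (fun t => ?_) (fun t => ?_)
      (by simp) ?_
    · exact (measurable_of_finite
        (({.state j} : Set (SSPState S)).indicator (1 : SSPState S → ℝ≥0∞))).comp
        (measurable_pi_apply (X := fun _ : ℕ => SSPState S) t)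
    · exact Eventually.of_forall fun s => Set.indicator_le_self' (by simp) _
    · filter_upwards [h i, htrap] with s ⟨t₀, ht₀⟩ hs
      have hall : ∀ t, t₀ ≤ t → s t = .terminal := fun t ht =>
        Nat.le_induction ht₀ (fun k _ hk => hs k hk) t ht
      refine tendsto_const_nhds.congr' ?_
      filter_upwards [eventually_ge_atTop t₀] with t ht
      simp [hall t ht]
  have heq : ∀ t, ∫⁻ s, ({.state j} : Set (SSPState S)).indicator 1 (s t) ∂M.pathLaw π i
      = ENNReal.ofReal ((M.transMatrix π ^ t) i j) := by
    intro t
    rw [← M.pathLaw_coord π i t j, ← lintegral_indicator_one (measurableSet_coord_eq _ _)]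
    rfl
  simp_rw [heq, lintegral_zero] at hlim
  have := (ENNReal.tendsto_toReal ENNReal.zero_ne_top).comp hlim
  simpa [Function.comp_def, ENNReal.toReal_ofReal (M.transMatrix_pow_nonneg π _ i j)] using this

theorem IsProper.eq_zero_of_mulVec {M : SSP S A} {π : S → A} (h : M.IsProper π) {v : S → ℝ}
    (hv : (M.transMatrix π).mulVec v = v) : v = 0 := by
  have hpow : ∀ t, (M.transMatrix π ^ t).mulVec v = v := by
    intro t
    induction t with
    | zero => simp
    | succ t ih => rw [pow_succ, ← Matrix.mulVec_mulVec, hv, ih]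
  have hlim : Tendsto (fun t => (M.transMatrix π ^ t).mulVec v) atTop
      (𝓝 ((0 : Matrix S S ℝ).mulVec v)) :=
    ((Continuous.matrix_mulVec continuous_id continuous_const).tendsto _).comp
      h.tendsto_transMatrix_pow
  simp_rw [hpow, Matrix.zero_mulVec] at hlim
  exact tendsto_nhds_unique tendsto_const_nhds hlim

/-- Since `Q ^ t → 0`, `Q` fixes no nonzero vector, so `1 - Q` is invertible and the geometric sums
`(1 - Q ^ n) * (1 - Q)⁻¹` converge. Nonnegative entries turn this into summability. -/
theorem IsProper.summable_transMatrix_pow {M : SSP S A} {π : S → A} (h : M.IsProper π) (i j : S) :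
    Summable fun t => (M.transMatrix π ^ t) i j := by
  set Q := M.transMatrix π
  have hu : IsUnit (1 - Q) := by
    rw [← Matrix.mulVec_injective_iff_isUnit]
    intro v w hvw
    have : Q.mulVec (v - w) = v - w := by
      simp only [Matrix.sub_mulVec, Matrix.one_mulVec] at hvw
      rw [Matrix.mulVec_sub]
      linear_combination (exp := 1) -hvw
    exact sub_eq_zero.1 (h.eq_zero_of_mulVec this)
  obtain ⟨u, hu⟩ := hu
  have hsum : ∀ n, ∑ t ∈ Finset.range n, Q ^ t = (1 - Q ^ n) * (↑u⁻¹ : Matrix S S ℝ) := by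
    intro n
    rw [← geom_sum_mul_neg, ← hu, mul_assoc, Units.mul_inv, mul_one]
  have hlim : Tendsto (fun n => ∑ t ∈ Finset.range n, Q ^ t) atTop
      (𝓝 ((1 - 0) * (↑u⁻¹ : Matrix S S ℝ))) := by
    simp_rw [hsum]
    exact (tendsto_const_nhds.sub h.tendsto_transMatrix_pow).mul tendsto_const_nhds
  have hij := tendsto_pi_nhds.1 (tendsto_pi_nhds.1 hlim i) j
  simp only [Matrix.sum_apply] at hij
  exact ((hasSum_iff_tendsto_nat_of_nonneg
    (fun t => M.transMatrix_pow_nonneg π t i j) _).2 hij).summable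

theorem integral_pathLaw_coord (π : S → A) (i : S) (t : ℕ) (f : SSPState S → ℝ)
    (hf : f .terminal = 0) :
    ∫ s, f (s t) ∂M.pathLaw π i = ∑ j, (M.transMatrix π ^ t) i j * f (.state j) := by
  have h : ∀ s : ℕ → SSPState S, f (s t)
      = ∑ j, {s : ℕ → SSPState S | s t = .state j}.indicator (fun _ => f (.state j)) s := by
    intro s
    cases hs : s t with
    | terminal => simp [Set.indicator, hs, hf]
    | state k => simp [Set.indicator, hs]
  simp_rw [h]
  rw [integral_finsetSum _ fun j _ => (integrable_const _).indicator (measurableSet_coord_eq t _)]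
  refine Finset.sum_congr rfl fun j _ => ?_
  rw [integral_indicator_const _ (measurableSet_coord_eq t _), Measure.real, M.pathLaw_coord,
    ENNReal.toReal_ofReal (M.transMatrix_pow_nonneg π t i j), smul_eq_mul]

theorem IsProper.hasSum_cost {M : SSP S A} {π : S → A} (h : M.IsProper π) (i : S) :
    HasSum (fun t => ∑ j, (M.transMatrix π ^ t) i j * M.g j (π j)) (M.cost π i) := by
  have hint : ∀ t, Integrable (fun s : ℕ → SSPState S => M.stageCost π (s t))
      (M.pathLaw π i) := fun t =>
    (Integrable.of_finite (f := M.stageCost π)).comp_measurable (measurable_pi_apply t)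
  have key := hasSum_integral_of_summable_integral_norm hint ?_
  · simp_rw [M.integral_pathLaw_coord π i _ (M.stageCost π) rfl] at key
    exact key
  · simp_rw [M.integral_pathLaw_coord π i _ (fun x => ‖M.stageCost π x‖) (by simp [stageCost])]
    exact summable_sum fun j _ => (h.summable_transMatrix_pow i j).mul_right _

/-- The cost-to-go of a proper policy is a fixed point of its dynamic programming operator. -/
theorem IsProper.policyOp_cost {M : SSP S A} {π : S → A} (h : M.IsProper π) :
    M.policyOp π (M.cost π) = M.cost π := by
  funext i
  -- Conditioning on the first transition: the cost series without its term at time 0 is the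
  -- transition average of the cost series of the successors.
  have h1 := (hasSum_nat_add_iff' 1).2 (h.hasSum_cost i)
  have h2 : HasSum (fun t => ∑ j, (M.transMatrix π ^ (t + 1)) i j * M.g j (π j))
      (∑ k, M.P i (π i) k * M.cost π k) := by
    refine (hasSum_sum fun k _ => (h.hasSum_cost k).mul_left (M.P i (π i) k)).congr_fun ?_
    intro t
    simp_rw [pow_succ', Matrix.mul_apply, Finset.sum_mul, Finset.mul_sum]
    rw [Finset.sum_comm]
    simp [mul_assoc, transMatrix]
  have := h1.unique h2
  simp [Matrix.one_apply] at this
  unfold policyOp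
  linarith

end SSP

/-! ### Comparison principle, Bellman equation and contraction weights. -/

namespace SSP

variable {S A : Type*} [Fintype S] (M : SSP S A)

theorem policyOp_mono (π : S → A) {J K : S → ℝ} (h : J ≤ K) :
    M.policyOp π J ≤ M.policyOp π K := fun _ =>
  add_le_add_right
    (Finset.sum_le_sum fun j _ => mul_le_mul_of_nonneg_left (h j) (M.P_nonneg _ _ _)) _

theorem policyOp_sub (π : S → A) (J K : S → ℝ) :
    M.policyOp π J - M.policyOp π K = (M.transMatrix π).mulVec (J - K) := by
  funext i
  simp only [policyOp, Pi.sub_apply, Matrix.mulVec, dotProduct, transMatrix, Matrix.of_apply,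
    mul_sub, Finset.sum_sub_distrib]
  ring

section Proper

variable [DecidableEq S] {M} {π : S → A}

/-- A minimum principle: iterating gives `v ≥ Q ^ t v`, and the right side tends to 0. Applied to
differences with `M.cost π`, it yields the two comparison lemmas below. -/
theorem IsProper.nonneg_of_mulVec_le (h : M.IsProper π) {v : S → ℝ}
    (hv : (M.transMatrix π).mulVec v ≤ v) : 0 ≤ v := by
  have hpow : ∀ t, (M.transMatrix π ^ t).mulVec v ≤ v := by
    intro t
    induction t with
    | zero => simp
    | succ t ih =>
      rw [pow_succ, ← Matrix.mulVec_mulVec]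
      refine le_trans (fun i => ?_) ih
      exact Finset.sum_le_sum fun j _ =>
        mul_le_mul_of_nonneg_left (hv j) (M.transMatrix_pow_nonneg π t i j)
  have hlim : Tendsto (fun t => (M.transMatrix π ^ t).mulVec v) atTop
      (𝓝 ((0 : Matrix S S ℝ).mulVec v)) :=
    ((Continuous.matrix_mulVec continuous_id continuous_const).tendsto _).comp
      h.tendsto_transMatrix_pow
  rw [Matrix.zero_mulVec] at hlim
  exact le_of_tendsto' hlim hpow

theorem IsProper.cost_le_of_policyOp_le (h : M.IsProper π) {J : S → ℝ}
    (hJ : M.policyOp π J ≤ J) : M.cost π ≤ J := by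
  refine sub_nonneg.1 (h.nonneg_of_mulVec_le ?_)
  rw [← policyOp_sub, h.policyOp_cost]
  exact sub_le_sub_right hJ _

theorem IsProper.le_cost_of_le_policyOp (h : M.IsProper π) {J : S → ℝ}
    (hJ : J ≤ M.policyOp π J) : J ≤ M.cost π := by
  refine sub_nonneg.1 (h.nonneg_of_mulVec_le ?_)
  rw [← policyOp_sub, h.policyOp_cost]
  exact sub_le_sub_left hJ _

end Proper

variable [Fintype A] [Nonempty A]

theorem bellmanOp_le_policyOp (π : S → A) (J : S → ℝ) : M.bellmanOp J ≤ M.policyOp π J :=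
  fun i => Finset.inf'_le (fun a => M.g i a + ∑ j, M.P i a j * J j) (Finset.mem_univ (π i))

theorem exists_isGreedy (J : S → ℝ) : ∃ π, M.IsGreedy J π := by
  have h : ∀ i, ∃ a, M.bellmanOp J i = M.g i a + ∑ j, M.P i a j * J j := fun i => by
    obtain ⟨a, -, ha⟩ := Finset.exists_mem_eq_inf' Finset.univ_nonempty
      fun a : A => M.g i a + ∑ j, M.P i a j * J j
    exact ⟨a, ha⟩
  choose π hπ using h
  exact ⟨π, funext fun i => (hπ i).symm⟩

variable [DecidableEq S]

theorem optCost_le_cost (π : S → A) : M.optCost ≤ M.cost π :=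
  fun i => Finset.inf'_le (fun π => M.cost π i) (Finset.mem_univ π)

variable {M} (hM : ∀ π : S → A, M.IsProper π)
include hM

/-- If all policies are proper, some policy is optimal from every initial state at once, and its
cost-to-go solves the Bellman equation. -/
theorem exists_cost_eq_optCost :
    ∃ π, M.cost π = M.optCost ∧ M.bellmanOp M.optCost = M.optCost := by
  -- Minimizing the sum over states gives a single policy. Its greedy improvement `σ` is no worse in
  -- any state, hence equal in every state, and this equality is the Bellman equation.
  obtain ⟨π, hπ⟩ := Finite.exists_min fun π : S → A => ∑ i, M.cost π i
  obtain ⟨σ, hσ⟩ := M.exists_isGreedy (M.cost π)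
  have h1 : M.policyOp σ (M.cost π) ≤ M.cost π := by
    rw [hσ]
    exact (M.bellmanOp_le_policyOp π _).trans (hM π).policyOp_cost.le
  have h2 : M.cost σ ≤ M.cost π := (hM σ).cost_le_of_policyOp_le h1
  have h3 : M.cost σ = M.cost π := by
    have h := (Finset.sum_eq_sum_iff_of_le fun i _ => h2 i).1
      (le_antisymm (Finset.sum_le_sum fun i _ => h2 i) (hπ σ))
    exact funext fun i => h i (Finset.mem_univ i)
  have h4 : M.bellmanOp (M.cost π) = M.cost π := by
    rw [← hσ, ← h3, (hM σ).policyOp_cost]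
  have h5 : M.cost π = M.optCost := by
    refine le_antisymm (fun i => Finset.le_inf' _ _ fun τ _ => ?_) (M.optCost_le_cost π)
    exact (hM τ).le_cost_of_le_policyOp (h4.symm.le.trans (M.bellmanOp_le_policyOp τ _)) i
  exact ⟨π, h5, h5 ▸ h4⟩

/-- If all policies are proper, all transition matrices contract one and the same weighted
maximum norm. -/
theorem exists_contraction_weights :
    ∃ (ξ : S → ℝ) (β : ℝ), 0 ≤ β ∧ β < 1 ∧ (∀ i, 1 ≤ ξ i) ∧
      ∀ i a, ∑ j, M.P i a j * ξ j ≤ β * ξ i := by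
  -- With cost -1 per stage, `-M'.optCost` is the largest expected time to termination; its Bellman
  -- equation yields `∑ j, M.P i a j * ξ j ≤ ξ i - 1`.
  let M' : SSP S A := ⟨M.P, fun _ _ => -1, M.P_nonneg, M.P_sum_le_one⟩
  have hM' : ∀ π, M'.IsProper π := hM
  obtain ⟨π, hπ, hB⟩ := exists_cost_eq_optCost hM'
  have hnonpos : M'.optCost ≤ 0 := by
    rw [← hπ]
    refine (hM' π).cost_le_of_policyOp_le fun i => ?_
    simp [policyOp, M']
  set ξ : S → ℝ := -M'.optCost with hξ
  have hξ0 : ∀ i, 0 ≤ ξ i := fun i => neg_nonneg.2 (hnonpos i)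
  have hstep : ∀ i a, ∑ j, M.P i a j * ξ j ≤ ξ i - 1 := by
    intro i a
    have h := M'.bellmanOp_le_policyOp (fun _ => a) M'.optCost i
    rw [hB] at h
    simp only [policyOp, M'] at h
    simp only [hξ, Pi.neg_apply, mul_neg, Finset.sum_neg_distrib, M']
    linarith
  have hξ1 : ∀ i, 1 ≤ ξ i := fun i => by
    have h : 0 ≤ ∑ j, M.P i (π i) j * ξ j :=
      Finset.sum_nonneg fun j _ => mul_nonneg (M.P_nonneg _ _ _) (hξ0 j)
    linarith [hstep i (π i)]
  -- Any `N ≥ 1` dominating all `ξ i` serves: `ξ i - 1 ≤ (1 - 1 / N) * ξ i`. The summand 1 keeps `N`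
  -- positive even when `S` is empty.
  set N : ℝ := 1 + ∑ i, ξ i with hN
  have hN1 : 1 ≤ N := by linarith [Finset.sum_nonneg fun i (_ : i ∈ Finset.univ) => hξ0 i]
  have hle : ∀ i, ξ i ≤ N := fun i => by
    linarith [Finset.single_le_sum (fun i _ => hξ0 i) (Finset.mem_univ i)]
  have hNpos : 0 < N := by linarith
  refine ⟨ξ, 1 - 1 / N, ?_, ?_, hξ1, fun i a => (hstep i a).trans ?_⟩
  · rw [sub_nonneg, div_le_one hNpos]
    exact hN1
  · linarith [one_div_pos.2 hNpos]
  · have : ξ i / N ≤ 1 := (div_le_one hNpos).2 (hle i)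
    rw [sub_mul, one_mul, one_div_mul_eq_div]
    linarith

end SSP

/-! ### Averaging recursions and martingale series. -/

/-- A sequence pulled towards `b` with nonsummable stepsizes eventually lies below any number
larger than `b`. -/
theorem eventually_le_of_averaging_le {γ x : ℕ → ℝ} {b ε : ℝ} (hε : 0 < ε)
    (hγ0 : Tendsto γ atTop (𝓝 0))
    (hγ_sum : Tendsto (fun N => ∑ t ∈ Finset.range N, γ t) atTop atTop)
    (hx : ∀ᶠ t in atTop, x (t + 1) ≤ (1 - γ t) * x t + γ t * b) :
    ∀ᶠ t in atTop, x t ≤ b + ε := by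
  obtain ⟨n, hn⟩ := eventually_atTop.1 (hx.and (hγ0.eventually_le_const (zero_lt_one' ℝ)))
  -- From `n` on the factors `1 - γ t` are nonnegative, so the excess over `b` is controlled by
  -- their product, at most the exponential of minus the sum of the stepsizes.
  have hbd : ∀ k, x (n + k) - b ≤
      Real.exp (-(∑ t ∈ Finset.range (n + k), γ t - ∑ t ∈ Finset.range n, γ t)) * |x n - b| := by
    intro k
    induction k with
    | zero => simpa using le_abs_self (x n - b)
    | succ k ih =>
      obtain ⟨h1, h2⟩ := hn (n + k) (Nat.le_add_right n k)
      calc x (n + k + 1) - b ≤ (1 - γ (n + k)) * (x (n + k) - b) := by linarith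
        _ ≤ (1 - γ (n + k)) * _ := mul_le_mul_of_nonneg_left ih (by linarith)
        _ ≤ Real.exp (-γ (n + k)) * _ := by
          refine mul_le_mul_of_nonneg_right ?_ (by positivity)
          linarith [Real.add_one_le_exp (-γ (n + k))]
        _ = _ := by
          rw [← mul_assoc, ← Real.exp_add, ← add_assoc, Finset.sum_range_succ]
          ring_nf
  have hlim : Tendsto (fun t => Real.exp (-(∑ s ∈ Finset.range t, γ s -
      ∑ s ∈ Finset.range n, γ s)) * |x n - b|) atTop (𝓝 (0 * |x n - b|)) := by
    refine Tendsto.mul_const _ (Real.tendsto_exp_neg_atTop_nhds_zero.comp ?_)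
    exact tendsto_atTop_add_const_right _ _ hγ_sum
  rw [zero_mul] at hlim
  filter_upwards [hlim.eventually_le_const hε, eventually_ge_atTop n] with t h1 h2
  obtain ⟨k, rfl⟩ := Nat.exists_eq_add_of_le h2
  linarith [hbd k]

/-- Averaging a convergent series with nonsummable stepsizes tending to zero gives a null
sequence. -/
theorem tendsto_zero_of_averaging {γ d X : ℕ → ℝ} {L : ℝ}
    (hγ_nonneg : ∀ t, 0 ≤ γ t) (hγ0 : Tendsto γ atTop (𝓝 0))
    (hγ_sum : Tendsto (fun N => ∑ t ∈ Finset.range N, γ t) atTop atTop)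
    (hd : Tendsto (fun N => ∑ t ∈ Finset.range N, d t) atTop (𝓝 L))
    (hX : ∀ t, X (t + 1) = (1 - γ t) * X t + d t) :
    Tendsto X atTop (𝓝 0) := by
  have upper : ∀ {d X : ℕ → ℝ} {L : ℝ},
      Tendsto (fun N => ∑ t ∈ Finset.range N, d t) atTop (𝓝 L) →
      (∀ t, X (t + 1) = (1 - γ t) * X t + d t) → ∀ ε > 0, ∀ᶠ t in atTop, X t ≤ ε := by
    intro d X L hd hX ε hε
    -- `U` absorbs the noise: `X - U` follows the recursion with `d t` replaced by `-γ t * U t`, a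
    -- pull towards the vanishing target `-U t`.
    set U : ℕ → ℝ := fun t => ∑ s ∈ Finset.range t, d s - L with hU
    have hU0 : Tendsto U atTop (𝓝 0) := by simpa using hd.sub_const L
    have h3 : 0 < ε / 3 := by positivity
    have hlow : ∀ᶠ t in atTop, -(ε / 3) ≤ U t := hU0.eventually_const_le (by linarith)
    have key := eventually_le_of_averaging_le (x := fun t => X t - U t) (b := ε / 3) h3 hγ0
      hγ_sum (by
        filter_upwards [hlow] with t ht
        have hs : U (t + 1) = U t + d t := by simp only [hU, Finset.sum_range_succ]; ring
        have := mul_le_mul_of_nonneg_left ht (hγ_nonneg t)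
        simp only [hX, hs]
        linarith)
    filter_upwards [key, hU0.eventually_le_const h3] with t h1 h2
    linarith
  refine Metric.tendsto_nhds.2 fun ε hε => ?_
  have hneg := upper (d := fun t => -d t) (X := fun t => -X t) (L := -L)
    (by simpa using hd.neg) (fun t => by rw [hX]; ring) (ε / 2) (by positivity)
  filter_upwards [upper hd hX (ε / 2) (by positivity), hneg] with t h1 h2
  rw [Real.dist_eq, sub_zero]
  exact (abs_le.2 ⟨by linarith, h1⟩).trans_lt (by linarith)

/-- A series of square integrable martingale differences with summable variances converges
almost surely. -/
theorem ae_exists_tendsto_sum_of_martingale_differences {Ω : Type*} {mΩ : MeasurableSpace Ω}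
    {Pr : Measure Ω} [IsProbabilityMeasure Pr] {ℱ : Filtration ℕ mΩ} {d : ℕ → Ω → ℝ} {c : ℕ → ℝ}
    (hd_meas : ∀ t, StronglyMeasurable[ℱ (t + 1)] (d t)) (hd_memLp : ∀ t, MemLp (d t) 2 Pr)
    (hd_mean : ∀ t, Pr[d t | ℱ t] =ᵐ[Pr] 0) (hd_var : ∀ t, ∫ ω, d t ω ^ 2 ∂Pr ≤ c t)
    (hc : Summable c) :
    ∀ᵐ ω ∂Pr, ∃ L, Tendsto (fun N => ∑ t ∈ Finset.range N, d t ω) atTop (𝓝 L) := by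
  set X : ℕ → Ω → ℝ := fun N => ∑ t ∈ Finset.range N, d t with hXdef
  have hX_meas : StronglyAdapted ℱ X := fun N => by
    refine Finset.stronglyMeasurable_sum _ fun t ht => (hd_meas t).mono (ℱ.mono ?_)
    exact Finset.mem_range.1 ht
  have hX_memLp : ∀ N, MemLp (X N) 2 Pr := fun N => memLp_finsetSum' _ fun t _ => hd_memLp t
  have hsucc : ∀ N, X (N + 1) = X N + d N := fun N => Finset.sum_range_succ _ _
  have hmart : Martingale X ℱ Pr := by
    refine martingale_of_condExp_sub_eq_zero_nat hX_meas
      (fun N => (hX_memLp N).integrable one_le_two) fun N => ?_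
    rw [hsucc, add_sub_cancel_left]
    exact hd_mean N
  -- `X N` contains only increments before time `N`, so it is known at time `N` and can be pulled
  -- out of the conditional expectation. Thus variances add.
  have horth : ∀ N, ∫ ω, X N ω * d N ω ∂Pr = 0 := by
    intro N
    have hint : Integrable (X N * d N) Pr := (hX_memLp N).integrable_mul (hd_memLp N)
    have h := condExp_mul_of_stronglyMeasurable_left (hX_meas N) hint
      ((hd_memLp N).integrable one_le_two)
    have h0 : Pr[X N * d N | ℱ N] =ᵐ[Pr] 0 := by
      filter_upwards [h, hd_mean N] with ω h1 h2
      rw [h1, Pi.mul_apply, h2]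
      simp
    calc ∫ ω, X N ω * d N ω ∂Pr = ∫ ω, (Pr[X N * d N | ℱ N]) ω ∂Pr :=
          (integral_condExp (ℱ.le N)).symm
      _ = 0 := by rw [integral_congr_ae h0]; simp
  have hvar : ∀ N, ∫ ω, X N ω ^ 2 ∂Pr ≤ ∑ t ∈ Finset.range N, c t := by
    intro N
    induction N with
    | zero => simp [hXdef]
    | succ N ih =>
      have hexp : ∀ ω, X (N + 1) ω ^ 2 = X N ω ^ 2 + 2 * (X N ω * d N ω) + d N ω ^ 2 := by
        intro ω
        rw [hsucc, Pi.add_apply]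
        ring
      have i1 := (hX_memLp N).integrable_sq
      have i2 : Integrable (fun ω => 2 * (X N ω * d N ω)) Pr :=
        ((hX_memLp N).integrable_mul (hd_memLp N)).const_mul 2
      have i3 := (hd_memLp N).integrable_sq
      simp_rw [hexp]
      have hsum : ∫ ω, (X N ω ^ 2 + 2 * (X N ω * d N ω) + d N ω ^ 2) ∂Pr
          = ∫ ω, (X N ω ^ 2 + 2 * (X N ω * d N ω)) ∂Pr + ∫ ω, d N ω ^ 2 ∂Pr :=
        integral_add (i1.add i2) i3
      rw [hsum, integral_add i1 i2, integral_const_mul, horth, Finset.sum_range_succ]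
      linarith [hd_var N]
  have hc_nonneg : ∀ t, 0 ≤ c t := fun t => (integral_nonneg fun ω => sq_nonneg _).trans (hd_var t)
  -- The L¹ bound comes from the L² bound through `|x| ≤ 1 + x ^ 2`.
  refine hmart.submartingale.exists_ae_tendsto_of_bdd (R := (1 + ∑' t, c t).toNNReal)
    (fun N => ?_) |>.mono fun ω ⟨L, hL⟩ => ⟨L, by simpa [hXdef] using hL⟩
  have hint : Integrable (X N) Pr := (hX_memLp N).integrable one_le_two
  rw [eLpNorm_one_eq_lintegral_enorm, ← ofReal_integral_norm_eq_lintegral_enorm hint]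
  refine ENNReal.ofReal_le_ofReal ?_
  calc ∫ ω, ‖X N ω‖ ∂Pr ≤ ∫ ω, (1 + X N ω ^ 2) ∂Pr := by
        refine integral_mono hint.norm ((integrable_const 1).add (hX_memLp N).integrable_sq) ?_
        intro ω
        simp only [Real.norm_eq_abs]
        nlinarith [sq_nonneg (|X N ω| - 1), sq_abs (X N ω), abs_nonneg (X N ω)]
    _ = 1 + ∫ ω, X N ω ^ 2 ∂Pr := by
        rw [integral_add (integrable_const 1) (hX_memLp N).integrable_sq]; simp
    _ ≤ 1 + ∑' t, c t := by
        linarith [hvar N, hc.sum_le_tsum (Finset.range N) fun t _ => hc_nonneg t]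

/-! ### Optimistic policy iteration along a fixed noise trajectory. -/

namespace SSP

variable {S A : Type*} [Fintype S] [Fintype A] [Nonempty A] {M : SSP S A}

/-- If the Bellman residual of `J` is at most `δ`, the cost-to-go of a greedy policy exceeds
`T J` by at most a multiple of `δ`. -/
theorem IsGreedy.cost_le [DecidableEq S] {J ξ : S → ℝ} {π : S → A} {β δ : ℝ}
    (hπ : M.IsGreedy J π) (hproper : M.IsProper π) (hβ0 : 0 ≤ β) (hβ1 : β < 1)
    (hξ1 : ∀ i, 1 ≤ ξ i) (hξ : ∀ i a, ∑ j, M.P i a j * ξ j ≤ β * ξ i) (hδ : 0 ≤ δ)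
    (hJ : ∀ i, M.bellmanOp J i ≤ J i + δ) (i : S) :
    M.cost π i ≤ M.bellmanOp J i + β / (1 - β) * δ * ξ i := by
  have h1β : 0 < 1 - β := by linarith
  -- The solution of `β * (δ + c) = c`, which is what makes `M.bellmanOp J + c * ξ` a supersolution
  -- for the policy operator of `π`.
  set c : ℝ := β / (1 - β) * δ with hc
  have hc0 : 0 ≤ c := by positivity
  have hcβ : β * (δ + c) = c := by
    rw [hc]
    field_simp
    ring
  refine hproper.cost_le_of_policyOp_le (J := fun i => M.bellmanOp J i + c * ξ i) (fun i => ?_) i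
  calc M.policyOp π (fun i => M.bellmanOp J i + c * ξ i) i
      ≤ M.policyOp π (fun i => J i + (δ + c) * ξ i) i := by
        refine M.policyOp_mono π (fun j => ?_) i
        have := mul_le_mul_of_nonneg_left (hξ1 j) hδ
        linarith [hJ j]
    _ = M.policyOp π J i + (δ + c) * ∑ j, M.P i (π i) j * ξ j := by
        simp only [policyOp, mul_add, Finset.sum_add_distrib, Finset.mul_sum]
        rw [add_assoc]
        simp only [mul_left_comm]
    _ ≤ M.bellmanOp J i + (δ + c) * (β * ξ i) :=
        add_le_add (congrFun hπ i).le (mul_le_mul_of_nonneg_left (hξ i _) (by positivity))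
    _ = M.bellmanOp J i + c * ξ i := by linear_combination ξ i * hcβ

/-- The upper half of the weighted contraction around a fixed point: for an upper bound it suffices
to test the policy greedy at `K`. -/
theorem bellmanOp_le_of_le {J K ξ : S → ℝ} {β e : ℝ} (hK : M.bellmanOp K = K)
    (hξ : ∀ i a, ∑ j, M.P i a j * ξ j ≤ β * ξ i) (he : 0 ≤ e)
    (hJ : ∀ i, J i ≤ K i + e * ξ i) (i : S) : M.bellmanOp J i ≤ K i + e * (β * ξ i) := by
  obtain ⟨π, hπ⟩ := M.exists_isGreedy K
  calc M.bellmanOp J i ≤ M.policyOp π J i := M.bellmanOp_le_policyOp π J i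
    _ ≤ M.policyOp π (fun i => K i + e * ξ i) i := M.policyOp_mono π hJ i
    _ = M.policyOp π K i + e * ∑ j, M.P i (π i) j * ξ j := by
        simp only [policyOp, mul_add, Finset.sum_add_distrib, Finset.mul_sum]
        rw [add_assoc]
        simp only [mul_left_comm]
    _ ≤ K i + e * (β * ξ i) :=
        add_le_add ((congrFun hπ i).trans (congrFun hK i)).le
          (mul_le_mul_of_nonneg_left (hξ i _) he)

/-- The sequence started at `0` that averages the increments `d`. -/
def averaged (γ d : ℕ → ℝ) : ℕ → ℝ
  | 0 => 0
  | t + 1 => (1 - γ t) * averaged γ d t + d t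

variable [DecidableEq S]

section Pathwise

variable (hM : ∀ π : S → A, M.IsProper π) {γ : ℕ → ℝ} (hγ_nonneg : ∀ t, 0 ≤ γ t)
  (hγ0 : Tendsto γ atTop (𝓝 0))
  (hγ_sum : Tendsto (fun N => ∑ t ∈ Finset.range N, γ t) atTop atTop)
  {J d : ℕ → S → ℝ} {π : ℕ → S → A}
  (hgreedy : ∀ t, M.IsGreedy (J t) (π t))
  (hstep : ∀ t i, J (t + 1) i = (1 - γ t) * J t i + γ t * M.cost (π t) i + d t i)
  (hd : ∀ i, ∃ L, Tendsto (fun N => ∑ t ∈ Finset.range N, d t i) atTop (𝓝 L))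
  (hPd : ∀ i j, ∃ L,
    Tendsto (fun N => ∑ t ∈ Finset.range N, M.P i (π t i) j * d t j) atTop (𝓝 L))

include hM hγ_nonneg hγ0 hγ_sum hgreedy hstep hd hPd in
/-- Along optimistic policy iteration the Bellman residual becomes nonpositive. -/
theorem eventually_bellmanOp_le {δ : ℝ} (hδ : 0 < δ) :
    ∀ᶠ t in atTop, ∀ i, M.bellmanOp (J t) i ≤ J t i + δ := by
  refine eventually_all.2 fun i => ?_
  choose L hL using hd
  choose L' hL' using hPd i
  set e : ℕ → ℝ := fun t => ∑ j, M.P i (π t i) j * d t j - d t i with he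
  have hsum : Tendsto (fun N => ∑ t ∈ Finset.range N, e t) atTop (𝓝 (∑ j, L' j - L i)) := by
    simp only [he, Finset.sum_sub_distrib]
    refine Tendsto.sub ?_ (hL i)
    simp_rw [Finset.sum_comm (s := Finset.range _)]
    exact tendsto_finsetSum _ fun j _ => hL' j
  have hX := tendsto_zero_of_averaging hγ_nonneg hγ0 hγ_sum hsum (X := averaged γ e)
    fun _ => rfl
  have hrec : ∀ t, M.bellmanOp (J (t + 1)) i - J (t + 1) i
      ≤ (1 - γ t) * (M.bellmanOp (J t) i - J t i) + e t := by
    intro t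
    have hc : M.policyOp (π t) (M.cost (π t)) i = M.cost (π t) i :=
      congrFun (hM (π t)).policyOp_cost i
    have hg : M.policyOp (π t) (J t) i = M.bellmanOp (J t) i := congrFun (hgreedy t) i
    -- The weights `1 - γ t` and `γ t` sum to 1 and are the same for all states, so the affine
    -- operator passes through the update.
    have haff : M.policyOp (π t) (J (t + 1)) i = (1 - γ t) * M.policyOp (π t) (J t) i
        + γ t * M.policyOp (π t) (M.cost (π t)) i + ∑ j, M.P i (π t i) j * d t j := by
      have : ∀ j, M.P i (π t i) j * J (t + 1) j = (1 - γ t) * (M.P i (π t i) j * J t j)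
          + γ t * (M.P i (π t i) j * M.cost (π t) j) + M.P i (π t i) j * d t j := fun j => by
        rw [hstep]; ring
      simp only [policyOp, this, Finset.sum_add_distrib, ← Finset.mul_sum]
      ring
    have h := M.bellmanOp_le_policyOp (π t) (J (t + 1)) i
    rw [haff, hc, hg] at h
    simp only [he]
    linarith [hstep t i]
  -- Subtracting the averaged noise cancels `e` and leaves a pull towards 0.
  have key := eventually_le_of_averaging_le (b := 0) (half_pos hδ) hγ0 hγ_sum
    (x := fun t => M.bellmanOp (J t) i - J t i - averaged γ e t)
    (Eventually.of_forall fun t => by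
      have := hrec t
      simp only [averaged]
      linarith)
  filter_upwards [key, hX.eventually_le_const (half_pos hδ)] with t h1 h2
  linarith

include hγ_nonneg hγ0 hγ_sum hstep hd in
-- Every target `M.cost (π t) i` is at least `M.optCost i`; the averaging lemma is applied to the
-- negative of the iterate with its averaged noise removed.
theorem eventually_optCost_sub_le {ε : ℝ} (hε : 0 < ε) (i : S) :
    ∀ᶠ t in atTop, M.optCost i - ε ≤ J t i := by
  obtain ⟨L, hL⟩ := hd i
  have hX := tendsto_zero_of_averaging hγ_nonneg hγ0 hγ_sum hL
    (X := averaged γ fun t => d t i) fun _ => rfl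
  have key := eventually_le_of_averaging_le (b := -M.optCost i) (half_pos hε) hγ0 hγ_sum
    (x := fun t => averaged γ (fun t => d t i) t - J t i)
    (Eventually.of_forall fun t => by
      have := mul_le_mul_of_nonneg_left (M.optCost_le_cost (π t) i) (hγ_nonneg t)
      simp only [averaged, hstep]
      linarith)
  have hneg : ∀ᶠ t in atTop, -(ε / 2) ≤ averaged γ (fun t => d t i) t :=
    hX.eventually_const_le (by linarith)
  filter_upwards [key, hneg] with t h1 h2
  linarith

include hM hγ_nonneg hγ0 hγ_sum hgreedy hstep hd hPd in
-- Once the residual is below `δ`, the targets are bounded by the contraction up to a multiple of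
-- `δ`. The weighted excess over `M.optCost`, noise removed, is then dominated by a scalar averaging
-- recursion. Choosing `κ` before `δ` lets the bound shrink to 0.
theorem exists_eventually_le_optCost_add :
    ∃ κ : S → ℝ, (∀ i, 0 < κ i) ∧
      ∀ δ > 0, ∀ᶠ t in atTop, ∀ i, J t i ≤ M.optCost i + κ i * δ := by
  obtain ⟨ξ, β, hβ0, hβ1, hξ1, hξ⟩ := exists_contraction_weights hM
  obtain ⟨-, -, hB⟩ := exists_cost_eq_optCost hM
  have h1β : 0 < 1 - β := by linarith
  have hξ0 : ∀ i, 0 < ξ i := fun i => zero_lt_one.trans_le (hξ1 i)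
  set c : ℝ := β / (1 - β) with hc
  have hc0 : 0 ≤ c := by positivity
  -- `(β + c) / (1 - β) * δ` is the fixed point of the scalar recursion; the 2 pays for its
  -- convergence error and for the noise `Y`, each at most `δ`.
  refine ⟨fun i => ((β + c) / (1 - β) + 2) * ξ i, fun i => by have := hξ0 i; positivity,
    fun δ hδ => ?_⟩
  set Y : ℕ → S → ℝ := fun t i => averaged γ (fun t => d t i) t with hY
  have hY0 : ∀ᶠ t in atTop, ∀ i, Y t i ≤ δ := by
    refine eventually_all.2 fun i => ?_
    obtain ⟨L, hL⟩ := hd i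
    exact (tendsto_zero_of_averaging hγ_nonneg hγ0 hγ_sum hL fun _ => rfl).eventually_le_const hδ
  obtain ⟨n, hn⟩ := eventually_atTop.1 (hY0.and ((eventually_bellmanOp_le hM hγ_nonneg hγ0 hγ_sum
    hgreedy hstep hd hPd hδ).and (hγ0.eventually_le_const (zero_lt_one' ℝ))))
  set K : ℝ := ∑ i, |J n i - Y n i - M.optCost i| with hK
  have hK0 : 0 ≤ K := Finset.sum_nonneg fun i _ => abs_nonneg _
  -- The scalar majorant, frozen at `K` up to time `n`, where the eventual bounds take over.
  let E : ℕ → ℝ := fun t => Nat.rec K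
    (fun t e => if t < n then K else (1 - γ t) * e + γ t * (β * (e + δ) + c * δ)) t
  have hE1 : ∀ t, n ≤ t → E (t + 1) = (1 - γ t) * E t + γ t * (β * (E t + δ) + c * δ) :=
    fun t ht => if_neg (not_lt.2 ht)
  have hEn : E n = K := by
    cases hn' : n with
    | zero => rfl
    | succ m => exact if_pos (by omega)
  have hbd : ∀ t, n ≤ t → 0 ≤ E t ∧ ∀ i, J t i - Y t i ≤ M.optCost i + E t * ξ i := by
    intro t ht
    induction t, ht using Nat.le_induction with
    | base =>
      rw [hEn]
      refine ⟨hK0, fun i => ?_⟩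
      have h1 : |J n i - Y n i - M.optCost i| ≤ K :=
        Finset.single_le_sum (f := fun i => |J n i - Y n i - M.optCost i|)
          (fun i _ => abs_nonneg _) (Finset.mem_univ i)
      have h2 := mul_le_mul_of_nonneg_left (hξ1 i) hK0
      linarith [le_abs_self (J n i - Y n i - M.optCost i)]
    | succ t ht ih =>
      obtain ⟨hE0, hZ⟩ := ih
      obtain ⟨hYt, hr, hγ1⟩ := hn t ht
      rw [hE1 t ht]
      have h1γ : 0 ≤ 1 - γ t := by linarith
      have hγt := hγ_nonneg t
      refine ⟨by positivity, fun i => ?_⟩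
      have hJt : ∀ i, J t i ≤ M.optCost i + (E t + δ) * ξ i := fun i => by
        have := mul_le_mul_of_nonneg_left (hξ1 i) hδ.le
        linarith [hZ i, hYt i]
      have h1 := (hgreedy t).cost_le (hM _) hβ0 hβ1 hξ1 hξ hδ.le hr i
      have h2 := bellmanOp_le_of_le hB hξ (by positivity : 0 ≤ E t + δ) hJt i
      have h3 : M.cost (π t) i ≤ M.optCost i + (β * (E t + δ) + c * δ) * ξ i := by linarith
      have h4 := mul_le_mul_of_nonneg_left h3 hγt
      have h5 := mul_le_mul_of_nonneg_left (hZ i) h1γ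
      have h6 : J (t + 1) i - Y (t + 1) i
          = (1 - γ t) * (J t i - Y t i) + γ t * M.cost (π t) i := by
        simp only [hY, averaged, hstep]
        ring
      rw [h6]
      linarith
  -- Collecting the terms in `E t` shows that `E` is averaged with the smaller stepsizes `(1 - β) *
  -- γ t`.
  have key := eventually_le_of_averaging_le (γ := fun t => (1 - β) * γ t) (x := E)
    (b := (β + c) / (1 - β) * δ) hδ (by simpa using hγ0.const_mul (1 - β))
    (by simpa only [← Finset.mul_sum] using hγ_sum.const_mul_atTop h1β) (by
      filter_upwards [eventually_ge_atTop n] with t ht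
      rw [hE1 t ht]
      refine le_of_eq ?_
      field_simp
      ring)
  filter_upwards [key, eventually_ge_atTop n] with t h1 h2 i
  have h3 := mul_le_mul_of_nonneg_right h1 (hξ0 i).le
  have h4 := mul_le_mul_of_nonneg_left (hξ1 i) hδ.le
  linarith [(hbd t h2).2 i, (hn t h2).1 i]

include hM hγ_nonneg hγ0 hγ_sum hgreedy hstep hd hPd in
/-- Optimistic policy iteration converges along every trajectory of the noise for which the noise
series converge. -/
theorem tendsto_optCost_of_tendsto_noise : Tendsto J atTop (𝓝 M.optCost) := by
  refine tendsto_pi_nhds.2 fun i => Metric.tendsto_nhds.2 fun ε hε => ?_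
  obtain ⟨κ, hκ, hup⟩ :=
    exists_eventually_le_optCost_add hM hγ_nonneg hγ0 hγ_sum hgreedy hstep hd hPd
  have hκi := hκ i
  filter_upwards [hup (ε / 2 / κ i) (by positivity),
    eventually_optCost_sub_le hγ_nonneg hγ0 hγ_sum hstep hd (half_pos hε) i] with t h1 h2
  have h3 := h1 i
  rw [mul_div_cancel₀ _ hκi.ne'] at h3
  rw [Real.dist_eq]
  exact (abs_le.2 ⟨by linarith, by linarith⟩ : _ ≤ ε / 2).trans_lt (by linarith)

end Pathwise

end SSP

/-! ### Almost sure convergence of the noise series, and the theorem. -/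

/-- A real function of a variable with finitely many values is measurable if the fibres of the
variable are. -/
theorem measurable_comp_of_measurableSet_fiber {Ω B : Type*} [Finite B] {m : MeasurableSpace Ω}
    {X : Ω → B} (hX : ∀ b, MeasurableSet {ω | X ω = b}) (f : B → ℝ) :
    Measurable fun ω => f (X ω) := by
  intro s _
  have : (fun ω => f (X ω)) ⁻¹' s = ⋃ b ∈ f ⁻¹' s, {ω | X ω = b} := by
    ext ω
    simp
  rw [this]
  exact MeasurableSet.biUnion (Set.to_countable _) fun b _ => hX b

theorem mainTheorem1 {S A : Type*} [Fintype S] [DecidableEq S] [Fintype A] [Nonempty A]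
    (M : SSP S A)
    (hproper : ∀ π : S → A, M.IsProper π)
    (γ : ℕ → ℝ) (hγ_nonneg : ∀ t, 0 ≤ γ t)
    (hγ_sum : Tendsto (fun N => ∑ t ∈ Finset.range N, γ t) atTop atTop)
    (hγ_sq : Summable fun t => γ t ^ 2)
    {Ω : Type*} {mΩ : MeasurableSpace Ω} (Pr : Measure Ω) [IsProbabilityMeasure Pr]
    (ℱ : Filtration ℕ mΩ)
    (J : ℕ → Ω → S → ℝ) (μ : ℕ → Ω → S → A) (w : ℕ → Ω → S → ℝ)
    (hJ_adapted : ∀ t, Measurable[ℱ t] (J t))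
    (hμ_adapted : ∀ t π, MeasurableSet[ℱ t] {ω | μ t ω = π})
    (hμ_greedy : ∀ t, ∀ᵐ ω ∂Pr, M.IsGreedy (J t ω) (μ t ω))
    (hJ_step : ∀ t, ∀ᵐ ω ∂Pr,
      J (t + 1) ω = (1 - γ t) • J t ω + γ t • (M.cost (μ t ω) + w t ω))
    (hw_memLp : ∀ t, MemLp (w t) 2 Pr)
    (hw_mean : ∀ t, Pr[w t | ℱ t] =ᵐ[Pr] 0)
    (C : ℝ)
    (hw_var : ∀ t, Pr[fun ω => ‖w t ω‖ ^ 2 | ℱ t] ≤ᵐ[Pr] fun _ => C) :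
    ∀ᵐ ω ∂Pr, Tendsto (fun t => J t ω) atTop (𝓝 M.optCost) := by
  have hγ0 : Tendsto γ atTop (𝓝 0) := by
    have h := (Real.continuous_sqrt.tendsto _).comp hγ_sq.tendsto_atTop_zero
    simpa [Function.comp_def, Real.sqrt_sq (hγ_nonneg _)] using h
  -- The noise is recovered from the iterates rather than set to `γ t * w t`: this makes it
  -- measurable at time `t + 1`, which is not assumed of `w t`, and makes the recursion hold for
  -- every `ω`.
  set d : ℕ → Ω → S → ℝ := fun t ω i =>
    J (t + 1) ω i - (1 - γ t) * J t ω i - γ t * M.cost (μ t ω) i with hd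
  have hd_eq : ∀ t, ∀ᵐ ω ∂Pr, ∀ i, d t ω i = γ t * w t ω i := fun t => by
    filter_upwards [hJ_step t] with ω h i
    simp only [hd, h, Pi.add_apply, Pi.smul_apply, smul_eq_mul]
    ring
  have hw_int : ∀ t, Integrable (w t) Pr := fun t => (hw_memLp t).integrable one_le_two
  have hw_sq : ∀ t, ∫ ω, ‖w t ω‖ ^ 2 ∂Pr ≤ C := fun t => by
    rw [← integral_condExp (ℱ.le t)]
    calc _ ≤ ∫ _, C ∂Pr := integral_mono_ae integrable_condExp (integrable_const C) (hw_var t)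
      _ = C := by simp
  have hwi_memLp : ∀ t i, MemLp (fun ω => w t ω i) 2 Pr := fun t i =>
    (ContinuousLinearMap.proj (R := ℝ) (φ := fun _ : S => ℝ) i).comp_memLp' (hw_memLp t)
  have hwi_mean : ∀ t i, Pr[fun ω => w t ω i | ℱ t] =ᵐ[Pr] 0 := fun t i => by
    have h := (ContinuousLinearMap.proj (R := ℝ) (φ := fun _ : S => ℝ) i).comp_condExp_comm
      (m := ℱ t) (hw_int t)
    refine h.symm.trans ?_
    filter_upwards [hw_mean t] with ω hω
    simp [hω]
  have hwi_sq : ∀ t i, ∫ ω, w t ω i ^ 2 ∂Pr ≤ C := fun t i => by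
    refine (integral_mono (hwi_memLp t i).integrable_sq (hw_memLp t).norm.integrable_sq
      fun ω => ?_).trans (hw_sq t)
    simp only
    rw [← sq_abs, ← Real.norm_eq_abs]
    exact pow_le_pow_left₀ (norm_nonneg _) (norm_le_pi_norm (w t ω) i) 2
  have hd_meas : ∀ t i, StronglyMeasurable[ℱ (t + 1)] fun ω => d t ω i := fun t i => by
    refine Measurable.stronglyMeasurable ?_
    have h1 : Measurable[ℱ (t + 1)] fun ω => J (t + 1) ω i :=
      (measurable_pi_apply i).comp (hJ_adapted (t + 1))
    have h2 : Measurable[ℱ (t + 1)] fun ω => J t ω i :=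
      ((measurable_pi_apply i).comp (hJ_adapted t)).mono (ℱ.mono t.le_succ) le_rfl
    have h3 : Measurable[ℱ (t + 1)] fun ω => M.cost (μ t ω) i :=
      (measurable_comp_of_measurableSet_fiber (hμ_adapted t) fun π => M.cost π i).mono
        (ℱ.mono t.le_succ) le_rfl
    exact (h1.sub (h2.const_mul _)).sub (h3.const_mul _)
  -- A bounded factor depending on `μ t`, which is known at time `t`, preserves martingale
  -- differences. The factor 1 gives the noise series, and the entries of `M.P` give the series
  -- transported by the current policy.
  have hconv : ∀ (i : S) (p : (S → A) → ℝ), (∀ π, |p π| ≤ 1) → ∀ᵐ ω ∂Pr, ∃ L,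
      Tendsto (fun N => ∑ t ∈ Finset.range N, p (μ t ω) * d t ω i) atTop (𝓝 L) := by
    intro i p hp
    have hp_meas : ∀ t, StronglyMeasurable[ℱ t] fun ω => p (μ t ω) := fun t =>
      (measurable_comp_of_measurableSet_fiber (hμ_adapted t) p).stronglyMeasurable
    have hdi_eq : ∀ t, (fun ω => d t ω i) =ᵐ[Pr] fun ω => γ t * w t ω i := fun t =>
      (hd_eq t).mono fun ω h => h i
    have hdi_memLp : ∀ t, MemLp (fun ω => d t ω i) 2 Pr := fun t =>
      ((hwi_memLp t i).const_mul (γ t)).ae_eq (hdi_eq t).symm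
    have hpd_memLp : ∀ t, MemLp (fun ω => p (μ t ω) * d t ω i) 2 Pr := fun t => by
      refine (hdi_memLp t).mono
        (((hp_meas t).mono (ℱ.le t)).aestronglyMeasurable.mul (hdi_memLp t).1)
        (Eventually.of_forall fun ω => ?_)
      rw [norm_mul]
      exact mul_le_of_le_one_left (norm_nonneg _) (hp _)
    refine ae_exists_tendsto_sum_of_martingale_differences (ℱ := ℱ)
      (c := fun t => γ t ^ 2 * C) (fun t => ?_) hpd_memLp (fun t => ?_) (fun t => ?_)
      (hγ_sq.mul_right C)
    · exact ((hp_meas t).mono (ℱ.mono t.le_succ)).mul (hd_meas t i)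
    · have h1 := condExp_mul_of_stronglyMeasurable_left (hp_meas t)
        ((hpd_memLp t).integrable one_le_two) ((hdi_memLp t).integrable one_le_two)
      have h2 : Pr[fun ω => d t ω i | ℱ t] =ᵐ[Pr] 0 := by
        refine (condExp_congr_ae (hdi_eq t)).trans ?_
        have h3 := condExp_smul (μ := Pr) (γ t) (fun ω => w t ω i) (ℱ t)
        refine h3.trans ?_
        filter_upwards [hwi_mean t i] with ω hω
        simp [hω]
      refine h1.trans ?_
      filter_upwards [h2] with ω hω
      simp [hω]
    · calc ∫ ω, (p (μ t ω) * d t ω i) ^ 2 ∂Pr ≤ ∫ ω, γ t ^ 2 * w t ω i ^ 2 ∂Pr := by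
            refine integral_mono_ae (hpd_memLp t).integrable_sq
              ((hwi_memLp t i).integrable_sq.const_mul _) ?_
            filter_upwards [hdi_eq t] with ω hω
            rw [hω, mul_pow, mul_pow]
            refine mul_le_of_le_one_left (by positivity) ?_
            rw [← sq_abs]
            exact pow_le_one₀ (abs_nonneg _) (hp _)
        _ ≤ γ t ^ 2 * C := by
            rw [integral_const_mul]
            exact mul_le_mul_of_nonneg_left (hwi_sq t i) (sq_nonneg _)
  have hP : ∀ i j (π : S → A), |M.P i (π i) j| ≤ 1 := fun i j π => by
    rw [abs_of_nonneg (M.P_nonneg _ _ _)]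
    exact (Finset.single_le_sum (fun k _ => M.P_nonneg i (π i) k) (Finset.mem_univ j)).trans
      (M.P_sum_le_one _ _)
  filter_upwards [ae_all_iff.2 hμ_greedy,
    ae_all_iff.2 fun i => hconv i (fun _ => 1) (by simp),
    ae_all_iff.2 fun i => ae_all_iff.2 fun j => hconv j (fun π => M.P i (π i) j) (hP i j)]
    with ω h1 h2 h3
  refine SSP.tendsto_optCost_of_tendsto_noise hproper hγ_nonneg hγ0 hγ_sum h1
    (d := fun t => d t ω) (fun t i => ?_) (by simpa using h2) h3
  simp only [hd]
  ring
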